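/- Let $k\ge 0$ be an integer, let $\Sigma=\{a_1,\dots,a_k\}$ be an alphabet of $k$ distinct letters, and identify each language $K\subseteq a_1^*a_2^*\cdots a_k^*$ over $\Sigma$ with the formal power series $\sum_{a_1^{d_1}\cdots a_k^{d_k}\in K} a_1^{d_1}\cdots a_k^{d_k}\in\mathbb F_2[[a_1,\dots,a_k]]$. Definitions. A *GF(2)-grammar* over $\Sigma$ is a context-free grammar (with finitely many nonterminals and rules) in which, for every nonterminal $A$ and every string $w\in\Sigma^*$, the number of parse trees of $w$ with root $A$ is finite; its language is the set of all strings that have an odd number of parse trees whose root is the initial nonterminal. Let $\mathcal A_j$ be the set of all power series in the single variable $a_j$ over $\mathbb F_2$ that are algebraic over $\mathbb F_2[a_j]$, and let $S_k$ be the ring of all finite sums $\sum_{i=1}^n A_{i,1}A_{i,2}\cdots A_{i,k}$ with $n\ge 0$ and $A_{i,j}\in\mathcal A_j$. For a set $Y$ of pairs $(i,j)$ with $1\le i<j\le k$, let $\mathrm{withinv}(S_k,Y)$ be the set of all power series of the form $\dfrac{t}{\prod_{(i,j)\in Y}p_{(i,j)}}$, where $t\in S_k$ and each $p_{(i,j)}\in\mathbb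 F_2[a_i,a_j]$ is a polynomial that is invertible in $\mathbb F_2[[a_1,\dots,a_k]]$ (that is, has constant term $1$). A set $Y$ of such pairs is *tree-like* if it is a possible result of the following recursive process, started on the segment $[1,k]$: on a segment $[\ell,r]$ with $\ell<r$, add $(\ell,r)$ to $Y$; if $r-\ell=1$, stop; otherwise choose some $m$ with $\ell<m<r$ and apply the process to $[\ell,m]$ and to $[m,r]$. (For $k\le 1$ there are no tree-like sets.) Theorem. Let $K\subseteq a_1^*a_2^*\cdots a_k^*$, and suppose that the power series of $K$ is a finite sum of power series, each of which lies in $\mathrm{withinv}(S_k,Y)$ for some tree-like set $Y$ (possibly different sets for different summands). Then $K$ is the language of some GF(2)-grammar over $\Sigma$. -/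

import Mathlib

/-! ## GF(2)-grammars -/

/-- Parse forests of a context-free grammar. An element of `ParseForest g s` is a sequence of
ordered parse trees whose roots are labelled, from left to right, by the symbols of `s`:
a terminal symbol is a leaf, and below a nonterminal symbol stands a rule of the grammar for this
nonterminal together with a forest over the right-hand side of this rule. In particular,
`ParseForest g [Symbol.nonterminal A]` is the type of parse trees with root `A`. -/
inductive ParseForest {T : Type} (g : ContextFreeGrammar T) :
    List (Symbol T g.NT) → Type
  | nil : ParseForest g []
  | terminal {s : List (Symbol T g.NT)} (a : T) (rest : ParseForest g s) :
      ParseForest g (Symbol.terminal a :: s)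
  | nonterminal {s : List (Symbol T g.NT)} (A : g.NT) (rhs : List (Symbol T g.NT))
      (hr : ⟨A, rhs⟩ ∈ g.rules) (children : ParseForest g rhs) (rest : ParseForest g s) :
      ParseForest g (Symbol.nonterminal A :: s)

/-- The yield of a parse forest: the string of its leaves, read from left to right. -/
def ParseForest.yield {T : Type} {g : ContextFreeGrammar T} :
    {s : List (Symbol T g.NT)} → ParseForest g s → List T
  | _, .nil => []
  | _, .terminal a rest => a :: rest.yield
  | _, .nonterminal _ _ _ children rest => children.yield ++ rest.yield

/-- The parse trees of the string `w` with root `A`. -/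
def ParseTree {T : Type} (g : ContextFreeGrammar T) (A : g.NT) (w : List T) : Type :=
  {t : ParseForest g [Symbol.nonterminal A] // t.yield = w}

/-- A GF(2)-grammar: a context-free grammar (finitely many nonterminals, finitely many rules)
in which every string has only finitely many parse trees. -/
structure GF2Grammar (T : Type) extends ContextFreeGrammar T where
  finite_NT : Finite NT
  finite_parseTree : ∀ (A : NT) (w : List T), Finite (ParseTree toContextFreeGrammar A w)

/-- The language of a GF(2)-grammar: the strings with an odd number of parse trees whose root is
the initial nonterminal. -/
def GF2Grammar.language {T : Type} (G : GF2Grammar T) : Language T :=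
  {w | Odd (Nat.card (ParseTree G.toContextFreeGrammar G.initial w))}

/-! ## Subsets of `a₁* a₂* ⋯ aₖ*` and power series

The letters `a₁, …, aₖ` are the elements of `Fin k`, in increasing order; they also serve as the
variables of the power series. -/

/-- The string `a₁ ^ d₁ a₂ ^ d₂ ⋯ aₖ ^ dₖ`. -/
def orderedWord {k : ℕ} (d : Fin k →₀ ℕ) : List (Fin k) :=
  (List.finRange k).flatMap fun i => List.replicate (d i) i

/-- The language `a₁* a₂* ⋯ aₖ*`. -/
def starProduct (k : ℕ) : Language (Fin k) :=
  Set.range (orderedWord (k := k))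

open Classical in
/-- The power series over `𝔽₂` that corresponds to a subset `K` of `a₁* a₂* ⋯ aₖ*`: the sum of the
monomials `a₁ ^ d₁ ⋯ aₖ ^ dₖ` over all strings `a₁ ^ d₁ ⋯ aₖ ^ dₖ` of `K`. -/
noncomputable def asSeries {k : ℕ} (K : Language (Fin k)) : MvPowerSeries (Fin k) (ZMod 2) :=
  fun d => if orderedWord d ∈ K then 1 else 0

/-! ## The sets of power series -/

/-- The algebraic power series in the single variable `aⱼ`: the series `f(aⱼ)`, where `f` is a
univariate power series over `𝔽₂` that is algebraic over the polynomials. -/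
def algSeries {k : ℕ} (j : Fin k) : Set (MvPowerSeries (Fin k) (ZMod 2)) :=
  {F | ∃ f : PowerSeries (ZMod 2), IsAlgebraic (Polynomial (ZMod 2)) f ∧
    F = PowerSeries.subst (MvPowerSeries.X j : MvPowerSeries (Fin k) (ZMod 2)) f}

/-- The ring `Sₖ`: all finite sums of products `A₁ A₂ ⋯ Aₖ`, where each `Aⱼ` is an algebraic power
series in the variable `aⱼ`. -/
def numeratorRing (k : ℕ) : Set (MvPowerSeries (Fin k) (ZMod 2)) :=
  {F | ∃ (n : ℕ) (A : Fin n → Fin k → MvPowerSeries (Fin k) (ZMod 2)),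
    (∀ i j, A i j ∈ algSeries j) ∧ F = ∑ i, ∏ j, A i j}

/-- The power series of the form `t / ∏_{(i, j) ∈ Y} p_{(i, j)}` with `t ∈ T`, where each
`p_{(i, j)}` is a polynomial in the variables `aᵢ, aⱼ` that is invertible as a power series. -/
def withInv {k : ℕ} (T : Set (MvPowerSeries (Fin k) (ZMod 2))) (Y : Finset (Fin k × Fin k)) :
    Set (MvPowerSeries (Fin k) (ZMod 2)) :=
  {F | ∃ t ∈ T, ∃ p : Fin k × Fin k → MvPolynomial (Fin k) (ZMod 2),
    (∀ e ∈ Y, p e ∈ MvPolynomial.supported (ZMod 2) ({e.1, e.2} : Set (Fin k)) ∧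
      IsUnit (p e : MvPowerSeries (Fin k) (ZMod 2))) ∧
    F * ∏ e ∈ Y, (p e : MvPowerSeries (Fin k) (ZMod 2)) = t}

/-! ## Tree-like sets -/

/-- `TreeLikeOn l r Y`: the set of pairs `Y` is a possible result of the recursive process on the
segment `[l, r]`. The process adds `(l, r)`; it stops there if `r = l + 1`, and otherwise it
chooses some `m` with `l < m < r` and continues on the segments `[l, m]` and `[m, r]`. -/
inductive TreeLikeOn {k : ℕ} : Fin k → Fin k → Finset (Fin k × Fin k) → Prop
  | base (l r : Fin k) (h : (l : ℕ) + 1 = r) : TreeLikeOn l r {(l, r)}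
  | split (l m r : Fin k) (hl : l < m) (hr : m < r) (Y₁ Y₂ : Finset (Fin k × Fin k))
      (h₁ : TreeLikeOn l m Y₁) (h₂ : TreeLikeOn m r Y₂) :
      TreeLikeOn l r (insert (l, r) (Y₁ ∪ Y₂))

/-- A tree-like set of pairs: a possible result of the recursive process on the whole segment,
from the first index to the last one. -/
def IsTreeLike {k : ℕ} (Y : Finset (Fin k × Fin k)) : Prop :=
  ∃ l r : Fin k, (l : ℕ) = 0 ∧ (r : ℕ) + 1 = k ∧ TreeLikeOn l r Y

/-!
A grammar is a system of equations for noncommutative power series over `𝔽₂`, one for each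
nonterminal. If every rule contains a terminal symbol or has only nonterminals of smaller rank on
its right-hand side, then, by induction on the length of the word and on the rank, each word has
finitely many parse trees, and their numbers modulo 2 are given by the solution of the system
(`ParseForest.counted_of_solution`). So it is enough to exhibit solutions. The series themselves
serve as the names of the nonterminals: a list of series in which each one satisfies a guarded
equation in itself and in later members (`WordSeries.Chain`) is a system, and two systems are merged
by appending lists. A series that occurs in such a list (`WordSeries.IsGF2`) is the
characteristic series of the language of a grammar (`WordSeries.IsGF2.exists_grammar`), and a series
satisfying a guarded equation with coefficients of this kind is again of this kind
(`WordSeries.isGF2_of_mem_span`).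

A commutative series in `a₁, …, aₖ` is turned into a series of sorted words
(`MvPowerSeries.toWordSeries`). This is linear, and it takes `F * G` to the Cauchy product if no
variable of `F` comes after a variable of `G` (`MvPowerSeries.toWordSeries_mul`). Three
constructions then give the result.

* An algebraic univariate series `f` satisfies a relation `∑ cᵢ f ^ 2 ^ i = 0` with polynomial
  coefficients; taking square roots of the relation, one may assume `c₀ ≠ 0`, and dividing `f` by the
  invertible part of `c₀`, that `c₀` is a power of the variable. As `f ↦ f ^ 2 ^ i` is additive,
  removing an initial part of `f` and dividing by a power of the variable leaves a series that
  satisfies a guarded equation (`PowerSeries.exists_guarded_equation`).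
* If `F * p = A`, where `p` is an invertible polynomial in the first and the last variable of
  a segment, then `F = A + (1 - p) * F`, and each term of `(1 - p) * F` stands for a rule that adds
  letters at the two ends of a word of `F` (`MvPowerSeries.isGF2_of_mul_eq`).
* Along a tree-like set, the quotients for `[l, m]` and `[m, r]` are multiplied by concatenation,
  which is possible because `aₘ` is the last variable of the former and the first variable of the
  latter (`TreeLikeOn.isGF2`).
-/

/-! ### Noncommutative power series and parse forests -/

/-- Formal power series over `𝔽₂` in noncommuting variables `T`, as functions on words. -/
abbrev WordSeries (T : Type) : Type := List T → ZMod 2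

namespace WordSeries

variable {T : Type}

/-- The Cauchy product of noncommutative series: the sum over all ways to cut a word in two. -/
def cauchyProd (φ ψ : WordSeries T) : WordSeries T := fun w =>
  ∑ i : Fin (w.length + 1), φ (w.take i) * ψ (w.drop i)

variable [DecidableEq T]

/-- The series of a single word. -/
def single (u : List T) : WordSeries T := fun w => if w = u then 1 else 0

theorem cauchyProd_single_nil (φ : WordSeries T) : cauchyProd φ (single []) = φ := by
  funext w
  rw [cauchyProd, Finset.sum_eq_single (Fin.last w.length)]
  · simp [single]
  · intro i _ hi
    have : (i : ℕ) < w.length := by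
      have := i.2
      have h2 : (i : ℕ) ≠ w.length := fun h => hi (Fin.ext h)
      omega
    simp [single, this]
  · simp

/-- The series of a symbol, given the series of the nonterminals. -/
def ofSymbol {N : Type} (val : N → WordSeries T) : Symbol T N → WordSeries T
  | .terminal a => single [a]
  | .nonterminal A => val A

/-- The series of the right-hand side of a rule, given the series of the nonterminals. -/
def ofSymbols {N : Type} (val : N → WordSeries T) : List (Symbol T N) → WordSeries T
  | [] => single []
  | x :: s => cauchyProd (ofSymbol val x) (ofSymbols val s)

theorem ofSymbols_singleton {N : Type} (val : N → WordSeries T) (x : Symbol T N) :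
    ofSymbols val [x] = ofSymbol val x :=
  cauchyProd_single_nil _

end WordSeries

/-- The number of terminal symbols in a sequence of symbols. -/
def terminalCount {T N : Type} : List (Symbol T N) → ℕ
  | [] => 0
  | .terminal _ :: s => terminalCount s + 1
  | .nonterminal _ :: s => terminalCount s

namespace ParseForest

open WordSeries

variable {T : Type} {g : ContextFreeGrammar T}

/-- The first tree of a forest and the remaining forest. -/
def uncons {x : Symbol T g.NT} {s : List (Symbol T g.NT)} :
    ParseForest g (x :: s) → ParseForest g [x] × ParseForest g s
  | .terminal a rest => (.terminal a .nil, rest)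
  | .nonterminal A rhs hr c rest => (.nonterminal A rhs hr c .nil, rest)

/-- The forest with a given first tree and a given remainder. -/
def cons {x : Symbol T g.NT} {s : List (Symbol T g.NT)} :
    ParseForest g [x] → ParseForest g s → ParseForest g (x :: s)
  | .terminal a _, rest => .terminal a rest
  | .nonterminal A rhs hr c _, rest => .nonterminal A rhs hr c rest

/-- A nonempty forest consists of its first tree and the remaining forest. -/
def consEquiv (x : Symbol T g.NT) (s : List (Symbol T g.NT)) :
    ParseForest g (x :: s) ≃ ParseForest g [x] × ParseForest g s where
  toFun := uncons
  invFun p := cons p.1 p.2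
  left_inv t := by cases t <;> rfl
  right_inv p := by
    obtain ⟨t, r⟩ := p
    cases t with
    | terminal a u => cases u; rfl
    | nonterminal A rhs hr c u => cases u; rfl

theorem yield_uncons {x : Symbol T g.NT} {s : List (Symbol T g.NT)} (t : ParseForest g (x :: s)) :
    t.yield = t.uncons.1.yield ++ t.uncons.2.yield := by
  cases t <;> simp [uncons, yield]

/-- A parse tree with root `A` consists of a rule for `A` and a forest over its right-hand side. -/
def treeEquiv (A : g.NT) : ParseForest g [Symbol.nonterminal A] ≃
    Σ r : {rhs : List (Symbol T g.NT) // (⟨A, rhs⟩ : ContextFreeRule T g.NT) ∈ g.rules},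
      ParseForest g r.1 where
  toFun
    | .nonterminal _ rhs hr c _ => ⟨⟨rhs, hr⟩, c⟩
  invFun p := .nonterminal A p.1.1 p.1.2 p.2 .nil
  left_inv t := by
    cases t with
    | nonterminal A rhs hr c u => cases u; rfl
  right_inv p := rfl

theorem yield_treeEquiv (A : g.NT) (t : ParseForest g [Symbol.nonterminal A]) :
    t.yield = (treeEquiv A t).2.yield := by
  cases t with
  | nonterminal A rhs hr c u => cases u; exact List.append_nil _

theorem terminalCount_le {s : List (Symbol T g.NT)} (t : ParseForest g s) :
    terminalCount s ≤ t.yield.length := by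
  induction t with
  | nil => simp [terminalCount]
  | terminal a rest ih => simpa [terminalCount, yield] using ih
  | nonterminal A rhs hr c rest _ ih => simp [terminalCount, yield]; omega

/-- The parse forests with a given yield. -/
abbrev Of (g : ContextFreeGrammar T) (s : List (Symbol T g.NT)) (w : List T) : Type :=
  {t : ParseForest g s // t.yield = w}

theorem ofCons_ext {x : Symbol T g.NT} {s : List (Symbol T g.NT)} {w : List T}
    {p q : Σ i : Fin (w.length + 1), Of g [x] (w.take i) × Of g s (w.drop i)}
    (h₁ : p.2.1.1 = q.2.1.1) (h₂ : p.2.2.1 = q.2.2.1) : p = q := by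
  obtain ⟨⟨i, hi⟩, ⟨t, ht⟩, ⟨r, hr⟩⟩ := p
  obtain ⟨⟨j, hj⟩, ⟨t', ht'⟩, ⟨r', hr'⟩⟩ := q
  dsimp only at h₁ h₂ ht ht'
  subst h₁ h₂
  have h := congrArg List.length (ht.symm.trans ht')
  simp only [List.length_take] at h
  obtain rfl : i = j := by omega
  rfl

/-- Forests with yield `w` correspond to cuts of `w`, the first tree yielding the first part. -/
def ofConsEquiv (x : Symbol T g.NT) (s : List (Symbol T g.NT)) (w : List T) :
    Of g (x :: s) w ≃ Σ i : Fin (w.length + 1), Of g [x] (w.take i) × Of g s (w.drop i) where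
  toFun t := ⟨⟨t.1.uncons.1.yield.length, by
      have := congrArg List.length (t.1.yield_uncons.symm.trans t.2)
      simp at this; omega⟩,
    ⟨t.1.uncons.1, List.take_left.symm.trans
      (congrArg (List.take _) (t.1.yield_uncons.symm.trans t.2))⟩,
    ⟨t.1.uncons.2, List.drop_left.symm.trans
      (congrArg (List.drop _) (t.1.yield_uncons.symm.trans t.2))⟩⟩
  invFun p := ⟨(consEquiv x s).symm (p.2.1.1, p.2.2.1), by
    rw [yield_uncons]
    change ((consEquiv x s) _).1.yield ++ ((consEquiv x s) _).2.yield = w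
    rw [Equiv.apply_symm_apply, p.2.1.2, p.2.2.2, List.take_append_drop]⟩
  left_inv t := Subtype.ext ((consEquiv x s).symm_apply_apply t.1)
  right_inv p := by
    have e := (consEquiv x s).apply_symm_apply (p.2.1.1, p.2.2.1)
    exact ofCons_ext (congrArg Prod.fst e) (congrArg Prod.snd e)

/-- Parse trees of `w` with root `A`, sorted by the rule at the root. -/
def ofTreeEquiv (A : g.NT) (w : List T) : Of g [Symbol.nonterminal A] w ≃
    Σ r : {rhs : List (Symbol T g.NT) // (⟨A, rhs⟩ : ContextFreeRule T g.NT) ∈ g.rules},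
      Of g r.1 w where
  toFun t := ⟨(treeEquiv A t.1).1, (treeEquiv A t.1).2, by rw [← yield_treeEquiv, t.2]⟩
  invFun p := ⟨(treeEquiv A).symm ⟨p.1, p.2.1⟩, by
    rw [yield_treeEquiv, Equiv.apply_symm_apply, p.2.2]⟩
  left_inv t := Subtype.ext ((treeEquiv A).symm_apply_apply t.1)
  right_inv p := rfl

variable [DecidableEq T]

/-- The forests over `s` with yield `w` are finite in number, and their number modulo 2 is the
coefficient at `w` of the series of `s`. -/
def Counted (g : ContextFreeGrammar T) (val : g.NT → WordSeries T) (s : List (Symbol T g.NT))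
    (w : List T) : Prop :=
  Finite (Of g s w) ∧ (Nat.card (Of g s w) : ZMod 2) = ofSymbols val s w

variable {val : g.NT → WordSeries T}

theorem counted_nil (w : List T) : Counted g val [] w := by
  by_cases h : w = []
  · subst h
    have : Unique (Of g [] []) :=
      { default := ⟨.nil, rfl⟩, uniq := fun ⟨t, _⟩ => by cases t; rfl }
    exact ⟨inferInstance, by simp [ofSymbols, single]⟩
  · have : IsEmpty (Of g [] w) := ⟨fun ⟨t, ht⟩ => by cases t; exact h ht.symm⟩
    exact ⟨inferInstance, by simp [ofSymbols, single, h]⟩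

theorem counted_terminal (a : T) (w : List T) : Counted g val [.terminal a] w := by
  unfold Counted
  rw [ofSymbols_singleton]
  by_cases h : w = [a]
  · subst h
    have : Unique (Of g [.terminal a] [a]) :=
      { default := ⟨.terminal a .nil, rfl⟩
        uniq := fun ⟨t, _⟩ => by cases t with | terminal _ u => cases u; rfl }
    exact ⟨inferInstance, by simp [ofSymbol, single]⟩
  · have : IsEmpty (Of g [.terminal a] w) := ⟨fun ⟨t, ht⟩ => by
      cases t with | terminal _ u => cases u; exact h ht.symm⟩
    exact ⟨inferInstance, by simp [ofSymbol, single, h]⟩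

theorem counted_cons {x : Symbol T g.NT} {s : List (Symbol T g.NT)} {w : List T}
    (h : ∀ i : Fin (w.length + 1), Finite (Of g [x] (w.take i) × Of g s (w.drop i)) ∧
      (Nat.card (Of g [x] (w.take i) × Of g s (w.drop i)) : ZMod 2) =
        ofSymbol val x (w.take i) * ofSymbols val s (w.drop i)) :
    Counted g val (x :: s) w := by
  have := fun i => (h i).1
  refine ⟨Finite.of_equiv _ (ofConsEquiv x s w).symm, ?_⟩
  rw [Nat.card_congr (ofConsEquiv x s w), Nat.card_sigma]
  push_cast
  exact Finset.sum_congr rfl fun i _ => (h i).2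

theorem Counted.prod {x : Symbol T g.NT} {s : List (Symbol T g.NT)} {u v : List T}
    (h₁ : Counted g val [x] u) (h₂ : Counted g val s v) :
    Finite (Of g [x] u × Of g s v) ∧
      (Nat.card (Of g [x] u × Of g s v) : ZMod 2) = ofSymbol val x u * ofSymbols val s v := by
  have := h₁.1
  have := h₂.1
  refine ⟨inferInstance, ?_⟩
  rw [Nat.card_prod, Nat.cast_mul, h₁.2, h₂.2, ofSymbols_singleton]

/-- Counting forests over `s` reduces to counting trees, and the terminal symbols of `s` bound the
length of the yields of these trees. -/
theorem counted_of_trees {s : List (Symbol T g.NT)} {w : List T}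
    (h : ∀ A, Symbol.nonterminal A ∈ s → ∀ u : List T, u.length + terminalCount s ≤ w.length →
      Counted g val [.nonterminal A] u) :
    Counted g val s w := by
  induction s generalizing w with
  | nil => exact counted_nil w
  | cons x s ih =>
    refine counted_cons fun i => ?_
    have hi := i.2
    cases x with
    | terminal a =>
      by_cases hw : w.take i = [a]
      · have hl := congrArg List.length hw
        rw [List.length_take, List.length_singleton] at hl
        refine (counted_terminal a _).prod (ih fun A hA u hu => h A (by simp [hA]) u ?_)
        rw [List.length_drop] at hu
        simp only [terminalCount]
        omega
      · have : IsEmpty (Of g [.terminal a] (w.take i)) := ⟨fun ⟨t, ht⟩ => by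
          cases t with | terminal _ u => cases u; exact hw ht.symm⟩
        exact ⟨inferInstance, by simp [ofSymbol, single, hw]⟩
    | nonterminal A =>
      have hs : Counted g val s (w.drop i) := ih fun B hB u hu => h B (by simp [hB]) u (by
        rw [List.length_drop] at hu
        simp only [terminalCount]
        omega)
      by_cases hd : (w.drop i).length < terminalCount s
      · -- The remaining symbols have more terminals than there are letters left.
        have : IsEmpty (Of g s (w.drop i)) :=
          ⟨fun ⟨t, ht⟩ => by have := t.terminalCount_le; rw [ht] at this; omega⟩
        refine ⟨inferInstance, ?_⟩
        rw [← hs.2]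
        simp
      · refine (h A (by simp) _ ?_).prod hs
        rw [List.length_drop] at hd
        rw [List.length_take]
        simp only [terminalCount]
        omega

theorem counted_tree {A : g.NT} {w : List T}
    (hval : val A w =
      ∑ᶠ r : {rhs : List (Symbol T g.NT) // (⟨A, rhs⟩ : ContextFreeRule T g.NT) ∈ g.rules},
        ofSymbols val r.1 w)
    (h : ∀ rhs, (⟨A, rhs⟩ : ContextFreeRule T g.NT) ∈ g.rules → Counted g val rhs w) :
    Counted g val [.nonterminal A] w := by
  have hfin : Finite {rhs : List (Symbol T g.NT) //
      (⟨A, rhs⟩ : ContextFreeRule T g.NT) ∈ g.rules} :=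
    Finite.of_injective (β := g.rules) (fun r => ⟨_, r.2⟩) fun r r' e => by
      simpa [Subtype.ext_iff] using e
  have := Fintype.ofFinite {rhs : List (Symbol T g.NT) //
      (⟨A, rhs⟩ : ContextFreeRule T g.NT) ∈ g.rules}
  have := fun r : {rhs : List (Symbol T g.NT) //
      (⟨A, rhs⟩ : ContextFreeRule T g.NT) ∈ g.rules} => (h r.1 r.2).1
  refine ⟨Finite.of_equiv _ (ofTreeEquiv A w).symm, ?_⟩
  rw [Nat.card_congr (ofTreeEquiv A w), Nat.card_sigma, ofSymbols_singleton, ofSymbol, hval,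
    finsum_eq_sum_of_fintype]
  push_cast
  exact Finset.sum_congr rfl fun r _ => (h r.1 r.2).2

/-- Let the rules of a grammar be guarded: each of them contains a terminal symbol or has only
nonterminals of smaller rank on its right-hand side. Then every word has finitely many parse trees,
and their numbers modulo 2 form the only solution of the system of equations given by the rules. -/
theorem counted_of_solution (rank : g.NT → ℕ)
    (hrank : ∀ A rhs, (⟨A, rhs⟩ : ContextFreeRule T g.NT) ∈ g.rules → 0 < terminalCount rhs ∨
      ∀ B, Symbol.nonterminal B ∈ rhs → rank B < rank A)
    (hval : ∀ A w, val A w =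
      ∑ᶠ r : {rhs : List (Symbol T g.NT) // (⟨A, rhs⟩ : ContextFreeRule T g.NT) ∈ g.rules},
        ofSymbols val r.1 w) (A : g.NT) (w : List T) :
    Counted g val [.nonterminal A] w := by
  induction hn : w.length using Nat.strong_induction_on generalizing A w with
  | _ n ihn =>
    induction hm : rank A using Nat.strong_induction_on generalizing A w with
    | _ m ihm =>
      refine counted_tree (hval A w) fun rhs hr => counted_of_trees fun B hB u hu => ?_
      by_cases hlt : u.length < n
      · exact ihn _ hlt B u rfl
      · rcases hrank A rhs hr with h | h
        · omega
        · exact ihm _ (hm ▸ h B hB) B u (by omega) rfl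

end ParseForest

/-! ### Series defined by triangular systems of equations -/

/-- Replace the nonterminal symbols. -/
def mapSymbol {T N M : Type} (f : N → M) : Symbol T N → Symbol T M
  | .terminal a => .terminal a
  | .nonterminal A => .nonterminal (f A)

theorem terminalCount_map {T N M : Type} (f : N → M) (s : List (Symbol T N)) :
    terminalCount (s.map (mapSymbol f)) = terminalCount s := by
  induction s with
  | nil => rfl
  | cons x s ih => cases x <;> simp [terminalCount, mapSymbol, ih]

theorem mapSymbol_injective {T N M : Type} {f : N → M} (hf : Function.Injective f) :
    Function.Injective (mapSymbol f : Symbol T N → Symbol T M) := by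
  rintro (a | A) (b | B) h <;> simp_all [mapSymbol, hf.eq_iff]

theorem exists_map_mapSymbol_val {T N : Type} {p : N → Prop} (s : List (Symbol T N))
    (h : ∀ A, Symbol.nonterminal A ∈ s → p A) :
    ∃ s' : List (Symbol T {A // p A}), s'.map (mapSymbol Subtype.val) = s := by
  induction s with
  | nil => exact ⟨[], rfl⟩
  | cons x s ih =>
    obtain ⟨s', hs'⟩ := ih fun A hA => h A (by simp [hA])
    cases x with
    | terminal a => exact ⟨.terminal a :: s', by simp [mapSymbol, hs']⟩
    | nonterminal A => exact ⟨.nonterminal ⟨A, h A (by simp)⟩ :: s', by simp [mapSymbol, hs']⟩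

namespace WordSeries

variable {T : Type}

/-- The right-hand sides that are allowed in the equation for `φ` when the series satisfying `p` are
already defined. The nonterminal symbols are the series themselves. The series `φ` may occur only
next to a terminal symbol. -/
def Admissible (p : WordSeries T → Prop) (φ : WordSeries T) : Set (List (Symbol T (WordSeries T))) :=
  {s | ∀ ψ, Symbol.nonterminal ψ ∈ s → p ψ ∨ ψ = φ ∧ 0 < terminalCount s}

theorem Admissible.mono {p q : WordSeries T → Prop} (h : ∀ ψ, p ψ → q ψ) (φ : WordSeries T) :
    Admissible p φ ⊆ Admissible q φ :=
  fun _ hs ψ hψ => (hs ψ hψ).imp_left (h ψ)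

variable [DecidableEq T]

theorem ofSymbols_map {N M : Type} (f : N → M) (val : M → WordSeries T) (s : List (Symbol T N)) :
    ofSymbols val (s.map (mapSymbol f)) = ofSymbols (fun A => val (f A)) s := by
  induction s with
  | nil => rfl
  | cons x s ih => cases x <;> simp [ofSymbols, mapSymbol, ofSymbol, ih]

/-- A list of series each of which satisfies a polynomial equation in itself and the later
series of the list. -/
inductive Chain : List (WordSeries T) → Prop
  | nil : Chain []
  | cons (φ : WordSeries T) (L : List (WordSeries T)) (hL : Chain L)
      (h : φ ∈ Submodule.span (ZMod 2) (ofSymbols id '' Admissible (· ∈ L) φ)) : Chain (φ :: L)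

/-- The series that belong to a chain, that is, can be defined by a guarded system of equations with
finitely many unknowns. -/
def IsGF2 (φ : WordSeries T) : Prop := ∃ L, Chain L ∧ φ ∈ L

theorem Chain.append {L M : List (WordSeries T)} (hL : Chain L) (hM : Chain M) :
    Chain (L ++ M) := by
  induction hL with
  | nil => exact hM
  | cons φ L _ h ih =>
    exact .cons φ _ ih (Submodule.span_mono (Set.image_mono
      (Admissible.mono (fun ψ => List.mem_append_left M) φ)) h)

theorem exists_chain_admissible {φ : WordSeries T} {s : List (Symbol T (WordSeries T))}
    (hs : s ∈ Admissible IsGF2 φ) : ∃ L, Chain L ∧ s ∈ Admissible (· ∈ L) φ := by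
  have key : ∀ t : List (Symbol T (WordSeries T)), t ⊆ s → ∃ L, Chain L ∧
      ∀ ψ, Symbol.nonterminal ψ ∈ t → ψ ∈ L ∨ ψ = φ ∧ 0 < terminalCount s := by
    intro t
    induction t with
    | nil => exact fun _ => ⟨[], .nil, by simp⟩
    | cons x t ih =>
      intro ht
      obtain ⟨L, hL, h⟩ := ih fun y hy => ht (by simp [hy])
      cases x with
      | terminal a => exact ⟨L, hL, by simpa using h⟩
      | nonterminal χ =>
        rcases hs χ (ht (by simp)) with ⟨M, hM, hχ⟩ | hχ
        · refine ⟨M ++ L, hM.append hL, fun ψ hψ => ?_⟩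
          rcases List.mem_cons.1 hψ with e | hψ
          · cases e
            exact .inl (by simp [hχ])
          · exact (h ψ hψ).imp_left fun h => by simp [h]
        · refine ⟨L, hL, fun ψ hψ => ?_⟩
          rcases List.mem_cons.1 hψ with e | hψ
          · cases e
            exact .inr hχ
          · exact h ψ hψ
  exact key s (List.Subset.refl s)

/-- A series is definable if it satisfies an equation whose other terms are definable. -/
theorem isGF2_of_mem_span {φ : WordSeries T}
    (h : φ ∈ Submodule.span (ZMod 2) (ofSymbols id '' Admissible IsGF2 φ)) : IsGF2 φ := by
  have key : ∀ χ ∈ Submodule.span (ZMod 2) (ofSymbols id '' Admissible IsGF2 φ), ∃ L, Chain L ∧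
      χ ∈ Submodule.span (ZMod 2) (ofSymbols id '' Admissible (· ∈ L) φ) := by
    intro χ hχ
    induction hχ using Submodule.span_induction with
    | mem χ hχ =>
      obtain ⟨s, hs, rfl⟩ := hχ
      obtain ⟨L, hL, hs⟩ := exists_chain_admissible hs
      exact ⟨L, hL, Submodule.subset_span ⟨s, hs, rfl⟩⟩
    | zero => exact ⟨[], .nil, zero_mem _⟩
    | add χ χ' _ _ h h' =>
      obtain ⟨L, hL, h⟩ := h
      obtain ⟨M, hM, h'⟩ := h'
      refine ⟨L ++ M, hL.append hM, add_mem (Submodule.span_mono (Set.image_mono ?_) h)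
        (Submodule.span_mono (Set.image_mono ?_) h')⟩
      · exact Admissible.mono (fun ψ => List.mem_append_left M) φ
      · exact Admissible.mono (fun ψ => List.mem_append_right L) φ
    | smul c χ _ h =>
      obtain ⟨L, hL, h⟩ := h
      exact ⟨L, hL, Submodule.smul_mem _ c h⟩
  obtain ⟨L, hL, h⟩ := key φ h
  exact ⟨φ :: L, .cons φ L hL h, by simp⟩

theorem IsGF2.mem_span {φ χ : WordSeries T} (h : IsGF2 χ) :
    χ ∈ Submodule.span (ZMod 2) (ofSymbols id '' Admissible IsGF2 φ) :=
  Submodule.subset_span ⟨[.nonterminal χ], fun ψ hψ => .inl (by simp_all), by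
    rw [ofSymbols_singleton]; rfl⟩

theorem isGF2_zero : IsGF2 (0 : WordSeries T) :=
  isGF2_of_mem_span (zero_mem _)

theorem IsGF2.add {φ ψ : WordSeries T} (hφ : IsGF2 φ) (hψ : IsGF2 ψ) : IsGF2 (φ + ψ) :=
  isGF2_of_mem_span (add_mem hφ.mem_span hψ.mem_span)

theorem IsGF2.cauchyProd {φ ψ : WordSeries T} (hφ : IsGF2 φ) (hψ : IsGF2 ψ) :
    IsGF2 (cauchyProd φ ψ) :=
  isGF2_of_mem_span (Submodule.subset_span ⟨[.nonterminal φ, .nonterminal ψ],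
    fun χ hχ => .inl (by simp at hχ; rcases hχ with rfl | rfl <;> assumption), by
    rw [ofSymbols, ofSymbols_singleton]; rfl⟩)

/-- The systems of equations of a chain, written as sums over finite sets of right-hand sides, with
a rank function that witnesses the triangular shape. -/
theorem Chain.exists_rules {L : List (WordSeries T)} (hL : Chain L) :
    ∃ (rank : WordSeries T → ℕ) (R : WordSeries T → Finset (List (Symbol T (WordSeries T)))),
      ∀ φ ∈ L, φ = ∑ s ∈ R φ, ofSymbols id s ∧ ∀ s ∈ R φ, ∀ ψ, Symbol.nonterminal ψ ∈ s →
        ψ ∈ L ∧ (0 < terminalCount s ∨ rank ψ < rank φ) := by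
  classical
  induction hL with
  | nil => exact ⟨fun _ => 0, fun _ => ∅, by simp⟩
  | cons φ L _ h ih =>
    obtain ⟨rank, R, hR⟩ := ih
    by_cases hφ : φ ∈ L
    · refine ⟨rank, R, fun ψ hψ => ?_⟩
      have hψ : ψ ∈ L := by rcases List.mem_cons.1 hψ with rfl | h <;> assumption
      exact ⟨(hR ψ hψ).1, fun s hs χ hχ => ((hR ψ hψ).2 s hs χ hχ).imp_left (by simp +contextual)⟩
    · obtain ⟨l, hl, hsum⟩ := (Finsupp.mem_span_image_iff_linearCombination _).1 h
      refine ⟨Function.update rank φ (L.toFinset.sup rank + 1), Function.update R φ l.support,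
        fun ψ hψ => ?_⟩
      rcases eq_or_ne ψ φ with rfl | hne
      · rw [Function.update_self]
        constructor
        · rw [← hsum, Finsupp.linearCombination_apply, Finsupp.sum]
          refine Finset.sum_congr rfl fun s hs => ?_
          have : ∀ c : ZMod 2, c ≠ 0 → c = 1 := by decide
          rw [this _ (Finsupp.mem_support_iff.1 hs), one_smul]
        · intro s hs χ hχ
          rcases hl hs χ hχ with hχL | ⟨rfl, ht⟩
          · refine ⟨by simp [hχL], .inr ?_⟩
            rw [Function.update_self, Function.update_of_ne (by rintro rfl; exact hφ hχL)]
            exact Nat.lt_succ_of_le (Finset.le_sup (f := rank) (List.mem_toFinset.2 hχL))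
          · exact ⟨by simp, .inl ht⟩
      · have hψL : ψ ∈ L := by simpa [hne] using hψ
        rw [Function.update_of_ne hne, Function.update_of_ne hne]
        refine ⟨(hR ψ hψL).1, fun s hs χ hχ => ?_⟩
        obtain ⟨hχL, h⟩ := (hR ψ hψL).2 s hs χ hχ
        rw [Function.update_of_ne (by rintro rfl; exact hφ hχL)]
        exact ⟨by simp [hχL], h⟩

/-- A series that belongs to a chain is the characteristic series of the language of
a `GF2Grammar`, whose nonterminals are the members of the chain. -/
theorem IsGF2.exists_grammar {φ : WordSeries T} (h : IsGF2 φ) :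
    ∃ G : GF2Grammar T, ∀ w, w ∈ G.language ↔ φ w = 1 := by
  obtain ⟨L, hL, hφ⟩ := h
  obtain ⟨rank, R, hR⟩ := hL.exists_rules
  have hNT : Finite {ψ // ψ ∈ L} := L.finite_toSet
  let S : Set (ContextFreeRule T {ψ // ψ ∈ L}) :=
    {r | r.output.map (mapSymbol Subtype.val) ∈ R r.input.1}
  have hmap : Function.Injective (List.map (mapSymbol Subtype.val) :
      List (Symbol T {ψ // ψ ∈ L}) → List (Symbol T (WordSeries T))) :=
    List.map_injective_iff.2 (mapSymbol_injective Subtype.val_injective)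
  have hS : S.Finite := by
    refine Finite.of_injective (β := Σ A : {ψ // ψ ∈ L}, R A.1)
      (fun r => ⟨r.1.input, ⟨_, r.2⟩⟩) ?_
    rintro ⟨⟨A, s⟩, hs⟩ ⟨⟨B, t⟩, ht⟩ e
    simp only [Sigma.mk.injEq] at e
    obtain ⟨rfl, e⟩ := e
    simpa [hmap.eq_iff] using e
  let g : ContextFreeGrammar T := ⟨{ψ // ψ ∈ L}, ⟨φ, hφ⟩, hS.toFinset⟩
  have hmem : ∀ (A : {ψ // ψ ∈ L}) (s : List (Symbol T {ψ // ψ ∈ L})),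
      (⟨A, s⟩ : ContextFreeRule T {ψ // ψ ∈ L}) ∈ g.rules ↔
        s.map (mapSymbol Subtype.val) ∈ R A.1 := fun A s => by simp [g, S]
  have key := ParseForest.counted_of_solution (g := g) (val := Subtype.val) (fun A => rank A.1) ?_ ?_
  · refine ⟨⟨g, hNT, fun A w => (key A w).1⟩, fun w => ?_⟩
    have := (key ⟨φ, hφ⟩ w).2
    rw [ofSymbols_singleton] at this
    change Odd (Nat.card (ParseForest.Of g _ w)) ↔ _
    rw [← ZMod.natCast_eq_one_iff_odd, this]
    rfl
  · intro A s hs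
    rw [hmem] at hs
    by_cases ht : 0 < terminalCount s
    · exact .inl ht
    · refine .inr fun B hB => ?_
      have := ((hR A.1 A.2).2 _ hs B.1 (List.mem_map.2 ⟨_, hB, rfl⟩)).2
      rw [terminalCount_map] at this
      exact this.resolve_left ht
  · intro A w
    let e : {s : List (Symbol T g.NT) // (⟨A, s⟩ : ContextFreeRule T g.NT) ∈ g.rules} → R A.1 :=
      fun s => ⟨_, (hmem A s.1).1 s.2⟩
    have he : Function.Bijective e := by
      refine ⟨fun s t h => Subtype.ext (hmap (congrArg Subtype.val h)), fun ⟨s, hs⟩ => ?_⟩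
      obtain ⟨s', rfl⟩ := exists_map_mapSymbol_val s fun ψ hψ => ((hR A.1 A.2).2 s hs ψ hψ).1
      exact ⟨⟨s', (hmem A s').2 hs⟩, rfl⟩
    calc A.1 w = ∑ s ∈ R A.1, ofSymbols id s w :=
          (congrFun (hR A.1 A.2).1 w).trans (Finset.sum_apply _ _ _)
      _ = ∑ᶠ s : R A.1, ofSymbols id s.1 w := by
          rw [finsum_eq_sum_of_fintype, ← Finset.sum_coe_sort]
      _ = _ := (finsum_eq_of_bijective e he fun s => by
          rw [ofSymbols_map]; rfl).symm

end WordSeries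

/-! ### Commutative series and series of sorted words -/

/-- The exponents of the monomial that is the commutative image of a word. -/
noncomputable def exponents {k : ℕ} (w : List (Fin k)) : Fin k →₀ ℕ :=
  Multiset.toFinsupp (w : Multiset (Fin k))

theorem exponents_apply {k : ℕ} (w : List (Fin k)) (i : Fin k) : exponents w i = w.count i := by
  simp [exponents]

theorem exponents_append {k : ℕ} (u v : List (Fin k)) :
    exponents (u ++ v) = exponents u + exponents v := by
  rw [exponents, ← Multiset.coe_add, map_add]; rfl

theorem exponents_eq_iff_perm {k : ℕ} {u v : List (Fin k)} :
    exponents u = exponents v ↔ u.Perm v := by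
  rw [exponents, exponents, Multiset.toFinsupp.injective.eq_iff, Multiset.coe_eq_coe]

theorem mem_support_exponents {k : ℕ} {w : List (Fin k)} {i : Fin k} :
    i ∈ (exponents w).support ↔ i ∈ w := by
  rw [Finsupp.mem_support_iff, exponents_apply, ← Nat.pos_iff_ne_zero, List.count_pos_iff]

theorem exponents_orderedWord {k : ℕ} (d : Fin k →₀ ℕ) : exponents (orderedWord d) = d := by
  ext j
  rw [exponents_apply, orderedWord, List.count_flatMap]
  have : (List.count j ∘ fun i : Fin k => List.replicate (d i) i) =
      fun i => if i = j then d j else 0 := by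
    funext i
    simp only [Function.comp, List.count_replicate, beq_iff_eq]
    split_ifs with h
    · rw [h]
    · rfl
  rw [this, ← Fin.sum_univ_def]
  simp

theorem pairwise_orderedWord {k : ℕ} (d : Fin k →₀ ℕ) : (orderedWord d).Pairwise (· ≤ ·) := by
  rw [orderedWord, List.pairwise_flatMap]
  refine ⟨fun i _ => List.pairwise_replicate.2 (.inr le_rfl),
    (List.pairwise_lt_finRange k).imp fun h x hx y hy => ?_⟩
  rw [List.eq_of_mem_replicate hx, List.eq_of_mem_replicate hy]
  exact h.le

theorem eq_of_exponents_eq {k : ℕ} {u v : List (Fin k)} (hu : u.Pairwise (· ≤ ·))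
    (hv : v.Pairwise (· ≤ ·)) (h : exponents u = exponents v) : u = v :=
  (exponents_eq_iff_perm.1 h).eq_of_pairwise (fun _ _ _ _ => le_antisymm) hu hv

theorem orderedWord_exponents {k : ℕ} {w : List (Fin k)} (hw : w.Pairwise (· ≤ ·)) :
    orderedWord (exponents w) = w :=
  eq_of_exponents_eq (pairwise_orderedWord _) hw (exponents_orderedWord _)

namespace MvPowerSeries

open WordSeries

/-- The algebra of power series in the variables from a set `s`. -/
def seriesOn {k : ℕ} (s : Set (Fin k)) : Subalgebra (ZMod 2) (MvPowerSeries (Fin k) (ZMod 2)) where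
  carrier := {F | ∀ d, coeff d F ≠ 0 → (d.support : Set (Fin k)) ⊆ s}
  mul_mem' {F G} hF hG d hd := by
    classical
    rw [coeff_mul] at hd
    obtain ⟨p, hp, hne⟩ := Finset.exists_ne_zero_of_sum_ne_zero hd
    rw [← Finset.HasAntidiagonal.mem_antidiagonal.1 hp]
    refine (Finset.coe_subset.2 Finsupp.support_add).trans ?_
    rw [Finset.coe_union]
    exact Set.union_subset (hF _ (left_ne_zero_of_mul hne)) (hG _ (right_ne_zero_of_mul hne))
  add_mem' {F G} hF hG d hd := by
    rw [map_add] at hd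
    by_cases h : coeff d F = 0
    · exact hG d fun h' => hd (by rw [h, h', add_zero])
    · exact hF d h
  algebraMap_mem' c d hd := by
    classical
    rw [algebraMap_apply, coeff_C] at hd
    simp_all

variable {k : ℕ} {s t : Set (Fin k)}

theorem seriesOn_mono (h : s ⊆ t) : seriesOn s ≤ seriesOn t :=
  fun _ hF d hd => (hF d hd).trans h

theorem X_mem_seriesOn {i : Fin k} (hi : i ∈ s) : X i ∈ seriesOn s := by
  classical
  intro d hd
  rw [coeff_X] at hd
  obtain rfl : d = Finsupp.single i 1 := by by_contra h; simp [h] at hd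
  exact (Finset.coe_subset.2 Finsupp.support_single_subset).trans (by simpa using hi)

theorem coe_mem_seriesOn {p : MvPolynomial (Fin k) (ZMod 2)}
    (hp : p ∈ MvPolynomial.supported (ZMod 2) s) :
    (p : MvPowerSeries (Fin k) (ZMod 2)) ∈ seriesOn s := by
  intro d hd i hi
  rw [MvPolynomial.coeff_coe] at hd
  exact MvPolynomial.mem_supported.1 hp
    ((MvPolynomial.mem_vars_iff_mem_support i).2 ⟨d, MvPolynomial.mem_support_iff.2 hd, hi⟩)

/-- A series that satisfies a proper linear equation involves no new variables. -/
theorem mem_seriesOn_of_eq_add_mul {F A q : MvPowerSeries (Fin k) (ZMod 2)} (hA : A ∈ seriesOn s)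
    (hq : q ∈ seriesOn s) (hq0 : constantCoeff q = 0) (h : F = A + q * F) : F ∈ seriesOn s := by
  classical
  intro d
  induction d using WellFoundedLT.induction with
  | _ d ih =>
    intro hd
    rw [h, map_add] at hd
    by_cases hAd : coeff d A = 0
    · rw [hAd, zero_add, coeff_mul] at hd
      obtain ⟨p, hp, hne⟩ := Finset.exists_ne_zero_of_sum_ne_zero hd
      have hp := Finset.HasAntidiagonal.mem_antidiagonal.1 hp
      have h1 := left_ne_zero_of_mul hne
      have h0 : p.1 ≠ 0 := by
        intro h0
        rw [h0, coeff_zero_eq_constantCoeff_apply, hq0] at h1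
        exact h1 rfl
      have hlt : p.2 < d := by
        rw [← hp]
        exact lt_add_of_pos_left _ (pos_iff_ne_zero.2 h0)
      rw [← hp]
      refine (Finset.coe_subset.2 Finsupp.support_add).trans ?_
      rw [Finset.coe_union]
      exact Set.union_subset (hq _ h1) (ih _ hlt (right_ne_zero_of_mul hne))
    · exact hA d hAd

/-- The noncommutative series of sorted words that corresponds to a commutative series. -/
noncomputable def toWordSeries :
    MvPowerSeries (Fin k) (ZMod 2) →ₗ[ZMod 2] WordSeries (Fin k) where
  toFun F w := if w.Pairwise (· ≤ ·) then coeff (exponents w) F else 0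
  map_add' F G := by
    funext w
    by_cases h : w.Pairwise (· ≤ ·) <;> simp [h]
  map_smul' c F := by
    funext w
    by_cases h : w.Pairwise (· ≤ ·) <;> simp [h]

theorem toWordSeries_apply (F : MvPowerSeries (Fin k) (ZMod 2)) (w : List (Fin k)) :
    toWordSeries F w = if w.Pairwise (· ≤ ·) then coeff (exponents w) F else 0 := rfl

/-- The commutative product agrees with the Cauchy product of noncommutative series if the variables
of the first factor precede those of the second one: both count the ways to cut a sorted word. -/
theorem toWordSeries_mul {F G : MvPowerSeries (Fin k) (ZMod 2)} (hF : F ∈ seriesOn s)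
    (hG : G ∈ seriesOn t) (hst : ∀ i ∈ s, ∀ j ∈ t, i ≤ j) :
    toWordSeries (F * G) = cauchyProd (toWordSeries F) (toWordSeries G) := by
  classical
  funext w
  rw [toWordSeries_apply, cauchyProd]
  split_ifs with hw
  · rw [coeff_mul]
    have htake : ∀ i, (w.take i).Pairwise (· ≤ ·) := fun i => hw.sublist (List.take_sublist i w)
    have hdrop : ∀ i, (w.drop i).Pairwise (· ≤ ·) := fun i => hw.sublist (List.drop_sublist i w)
    simp only [toWordSeries_apply, htake, hdrop, if_true]
    symm
    refine Finset.sum_bij_ne_zero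
      (fun (i : Fin (w.length + 1)) _ _ => (exponents (w.take i), exponents (w.drop i)))
      ?_ ?_ ?_ ?_
    · intro i _ _
      rw [Finset.HasAntidiagonal.mem_antidiagonal, ← exponents_append, List.take_append_drop]
    · intro i _ _ j _ _ h
      have := (exponents_eq_iff_perm.1 (congrArg Prod.fst h)).length_eq
      simp only [List.length_take] at this
      ext
      omega
    · rintro ⟨a, b⟩ hab hne
      have hsorted : (orderedWord a ++ orderedWord b).Pairwise (· ≤ ·) := by
        refine List.pairwise_append.2 ⟨pairwise_orderedWord a, pairwise_orderedWord b,
          fun x hx y hy => hst x ?_ y ?_⟩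
        · rw [← mem_support_exponents, exponents_orderedWord] at hx
          exact hF a (left_ne_zero_of_mul hne) hx
        · rw [← mem_support_exponents, exponents_orderedWord] at hy
          exact hG b (right_ne_zero_of_mul hne) hy
      obtain rfl : orderedWord a ++ orderedWord b = w := eq_of_exponents_eq hsorted hw (by
        rw [exponents_append, exponents_orderedWord, exponents_orderedWord,
          Finset.HasAntidiagonal.mem_antidiagonal.1 hab])
      refine ⟨⟨(orderedWord a).length, by simp⟩, Finset.mem_univ _, ?_, ?_⟩ <;>
        simp [exponents_orderedWord, hne]
    · intro i _ _
      rfl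
  · symm
    refine Finset.sum_eq_zero fun i _ => ?_
    by_contra hne
    have h1 := left_ne_zero_of_mul hne
    have h2 := right_ne_zero_of_mul hne
    rw [toWordSeries_apply] at h1 h2
    split_ifs at h1 with hw1
    · split_ifs at h2 with hw2
      · refine hw ?_
        rw [← List.take_append_drop i w]
        exact List.pairwise_append.2 ⟨hw1, hw2, fun x hx y hy =>
          hst x (hF _ h1 (mem_support_exponents.2 hx)) y (hG _ h2 (mem_support_exponents.2 hy))⟩
      · exact h2 rfl
    · exact h1 rfl

theorem toWordSeries_one : toWordSeries (1 : MvPowerSeries (Fin k) (ZMod 2)) = single [] := by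
  classical
  funext w
  rw [toWordSeries_apply, coeff_one, single]
  have : exponents w = 0 ↔ w = [] := by
    rw [exponents, map_eq_zero_iff _ Multiset.toFinsupp.injective, Multiset.coe_eq_zero]
  by_cases h : w = []
  · rw [this.2 h]
    simp [h]
  · simp [this, h]

theorem toWordSeries_X (i : Fin k) :
    toWordSeries (X i : MvPowerSeries (Fin k) (ZMod 2)) = single [i] := by
  classical
  funext w
  rw [toWordSeries_apply, coeff_X, single]
  have : exponents w = Finsupp.single i 1 ↔ w = [i] := by
    rw [exponents, ← Multiset.toFinsupp_singleton, Multiset.toFinsupp.injective.eq_iff,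
      Multiset.coe_eq_singleton]
  by_cases h : w = [i]
  · rw [this.2 h]
    simp [h]
  · simp [this, h]

theorem ofSymbols_replicate_append {N : Type} {val : N → WordSeries (Fin k)} {i : Fin k} (n : ℕ)
    {u : List (Symbol (Fin k) N)} {G : MvPowerSeries (Fin k) (ZMod 2)}
    (hu : ofSymbols val u = toWordSeries G) (hG : G ∈ seriesOn (Set.Ici i)) :
    ofSymbols val (List.replicate n (.terminal i) ++ u) = toWordSeries (X i ^ n * G) := by
  induction n with
  | zero => simpa using hu
  | succ n ih =>
    rw [List.replicate_succ, List.cons_append, ofSymbols, ih, ofSymbol, ← toWordSeries_X, pow_succ',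
      mul_assoc, toWordSeries_mul (X_mem_seriesOn (Set.mem_singleton i))
        (mul_mem (pow_mem (X_mem_seriesOn Set.self_mem_Ici) n) hG) (by simp)]

theorem ofSymbols_replicate {N : Type} {val : N → WordSeries (Fin k)} (i : Fin k) (n : ℕ) :
    ofSymbols val (List.replicate n (.terminal i)) = toWordSeries (X i ^ n) := by
  have := ofSymbols_replicate_append (val := val) n (i := i) (u := []) (G := 1)
    toWordSeries_one.symm (one_mem _)
  simpa using this

theorem terminalCount_append {T N : Type} (u v : List (Symbol T N)) :
    terminalCount (u ++ v) = terminalCount u + terminalCount v := by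
  induction u with
  | nil => simp [terminalCount]
  | cons x u ih => cases x <;> simp [terminalCount, ih]; omega

theorem terminalCount_replicate {T N : Type} (a : T) (n : ℕ) :
    terminalCount (List.replicate n (Symbol.terminal a : Symbol T N)) = n := by
  induction n with
  | zero => rfl
  | succ n ih => simp [List.replicate_succ, terminalCount, ih]

/-- The term `aₗ ^ m * F * aᵣ ^ n` is the series of the right-hand side `aₗ ^ m F aᵣ ^ n`, which is
allowed in the equation for `F`, as `(m, n) ≠ (0, 0)`. -/
theorem mul_mul_mem_span {l r : Fin k} (hlr : l ≤ r) {F : MvPowerSeries (Fin k) (ZMod 2)}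
    (hF : F ∈ seriesOn (Set.Icc l r)) {m n : ℕ} (hmn : 0 < m + n) :
    toWordSeries (X l ^ m * (F * X r ^ n)) ∈ Submodule.span (ZMod 2)
      (ofSymbols id '' Admissible IsGF2 (toWordSeries F)) := by
  refine Submodule.subset_span ⟨List.replicate m (.terminal l) ++
    .nonterminal (toWordSeries F) :: List.replicate n (.terminal r), ?_, ?_⟩
  · intro ψ hψ
    refine .inr ⟨by simpa using hψ, ?_⟩
    simp only [terminalCount_append, terminalCount, terminalCount_replicate]
    exact hmn
  · refine ofSymbols_replicate_append m ?_ (mul_mem (seriesOn_mono Set.Icc_subset_Ici_self hF)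
      (pow_mem (X_mem_seriesOn hlr) n))
    rw [ofSymbols, ofSymbols_replicate, ofSymbol, id, toWordSeries_mul hF
      (pow_mem (X_mem_seriesOn (Set.mem_singleton r)) n) (by simp +contextual)]

end MvPowerSeries

/-! ### Algebraic univariate series -/

/-- The powers `f ^ e i` of an algebraic element `f` are linearly dependent, as the powers of an
integral element generate a finite module. -/
theorem IsAlgebraic.exists_sum_smul_pow_eq_zero {R S : Type} [CommRing R] [IsDomain R]
    [IsNoetherianRing R] [CommRing S] [Algebra R S] {f : S} (hf : IsAlgebraic R f) (e : ℕ → ℕ) :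
    ∃ (n : ℕ) (c : ℕ → R), ∑ i ∈ Finset.range n, c i • f ^ e i = 0 ∧ ∃ j < n, c j ≠ 0 := by
  obtain ⟨a, ha, hint⟩ := hf.exists_integral_multiple
  have hnoeth : IsNoetherian R (Algebra.adjoin R {a • f}) :=
    isNoetherian_of_fg_of_noetherian _ hint.fg_adjoin_singleton
  let b : ℕ → Algebra.adjoin R {a • f} := fun i =>
    ⟨(a • f) ^ e i, pow_mem (Algebra.self_mem_adjoin_singleton R _) _⟩
  have hb : ¬ LinearIndependent R b := fun h =>
    not_finite_iff_infinite.2 inferInstance h.finite_of_isNoetherian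
  rw [linearIndependent_iff] at hb
  push Not at hb
  obtain ⟨l, hl, hne⟩ := hb
  obtain ⟨j, hj⟩ := Finsupp.support_nonempty_iff.2 hne
  refine ⟨l.support.sup id + 1, fun i => l i * a ^ e i, ?_, j,
    Nat.lt_succ_of_le (Finset.le_sup (f := id) hj),
    mul_ne_zero (Finsupp.mem_support_iff.1 hj) (pow_ne_zero _ ha)⟩
  have h := congrArg (Subalgebra.val _) hl
  rw [Finsupp.linearCombination_apply, Finsupp.sum_of_support_subset l (s := Finset.range
    (l.support.sup id + 1)) (fun i hi => Finset.mem_range.2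
      (Nat.lt_succ_of_le (Finset.le_sup (f := id) hi))) _ (by simp), map_sum, map_zero] at h
  rw [← h]
  refine Finset.sum_congr rfl fun i _ => ?_
  rw [map_smul, mul_smul, ← smul_pow, Subalgebra.coe_val]

namespace PowerSeries

instance charP_two : CharP (PowerSeries (ZMod 2)) 2 :=
  charP_of_injective_algebraMap (algebraMap (ZMod 2) (PowerSeries (ZMod 2))).injective 2

theorem exists_eq_sq_add_X_mul_sq (c : Polynomial (ZMod 2)) :
    ∃ a b : Polynomial (ZMod 2), c = a ^ 2 + Polynomial.X * b ^ 2 := by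
  induction c using Polynomial.induction_on' with
  | add p q hp hq =>
    obtain ⟨a, b, rfl⟩ := hp
    obtain ⟨a', b', rfl⟩ := hq
    exact ⟨a + a', b + b', by rw [CharTwo.add_sq, CharTwo.add_sq]; ring⟩
  | monomial n r =>
    have hr : (Polynomial.C r) ^ 2 = Polynomial.C r := by rw [← Polynomial.C_pow, ZMod.pow_card]
    obtain ⟨m, rfl | rfl⟩ := n.even_or_odd'
    · refine ⟨Polynomial.C r * Polynomial.X ^ m, 0, ?_⟩
      rw [← Polynomial.C_mul_X_pow_eq_monomial, mul_pow, hr]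
      ring
    · refine ⟨0, Polynomial.C r * Polynomial.X ^ m, ?_⟩
      rw [← Polynomial.C_mul_X_pow_eq_monomial, mul_pow, hr]
      ring

/-- In characteristic 2 the squares and the `X`-multiples of squares are independent, as can be
seen by differentiation. -/
theorem eq_zero_of_sq_add_X_mul_sq {A B : PowerSeries (ZMod 2)} (h : A ^ 2 + X * B ^ 2 = 0) :
    A = 0 ∧ B = 0 := by
  have h2 : (2 : PowerSeries (ZMod 2)) = 0 := CharTwo.two_eq_zero
  have hB : B = 0 := by
    have hd := congrArg (derivative (ZMod 2)) h
    rw [map_add, Derivation.leibniz_pow, Derivation.leibniz, Derivation.leibniz_pow, map_zero,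
      derivative_X] at hd
    simp only [smul_eq_mul, nsmul_eq_mul, Nat.cast_ofNat, h2, zero_mul, mul_zero, zero_add,
      mul_one] at hd
    exact pow_eq_zero_iff two_ne_zero |>.1 hd
  subst hB
  exact ⟨by simpa using h, rfl⟩

theorem sum_sq_mul_pow {ι : Type} (s : Finset ι) (a : ι → Polynomial (ZMod 2)) (e : ι → ℕ)
    (f : PowerSeries (ZMod 2)) :
    (∑ i ∈ s, (a i : PowerSeries (ZMod 2)) * f ^ e i) ^ 2 =
      ∑ i ∈ s, (a i : PowerSeries (ZMod 2)) ^ 2 * f ^ (2 * e i) := by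
  rw [CharTwo.sum_sq]
  exact Finset.sum_congr rfl fun i _ => by ring

/-- Extracting square roots, one arrives at a linear relation that involves `f` itself. -/
theorem exists_sum_mul_pow_eq_zero {f : PowerSeries (ZMod 2)}
    (hf : IsAlgebraic (Polynomial (ZMod 2)) f) :
    ∃ (n : ℕ) (c : ℕ → Polynomial (ZMod 2)),
      ∑ i ∈ Finset.range (n + 1), (c i : PowerSeries (ZMod 2)) * f ^ 2 ^ i = 0 ∧ c 0 ≠ 0 := by
  obtain ⟨n, c, hc, j, hj, hcj⟩ := hf.exists_sum_smul_pow_eq_zero (2 ^ ·)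
  simp only [Algebra.smul_def, algebraMap_apply', Algebra.algebraMap_self, map_id, id] at hc
  induction j generalizing n c with
  | zero =>
    obtain ⟨n, rfl⟩ := Nat.exists_eq_succ_of_ne_zero hj.ne'
    exact ⟨n, c, hc, hcj⟩
  | succ j ih =>
    obtain ⟨n, rfl⟩ := Nat.exists_eq_succ_of_ne_zero (Nat.ne_zero_of_lt hj)
    by_cases h0 : c 0 = 0
    · choose a b hab using fun i => exists_eq_sq_add_X_mul_sq (c (i + 1))
      rw [Finset.sum_range_succ', h0] at hc
      have hsq : (∑ i ∈ Finset.range n, (a i : PowerSeries (ZMod 2)) * f ^ 2 ^ i) ^ 2 +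
          X * (∑ i ∈ Finset.range n, (b i : PowerSeries (ZMod 2)) * f ^ 2 ^ i) ^ 2 = 0 := by
        rw [sum_sq_mul_pow, sum_sq_mul_pow, Finset.mul_sum, ← Finset.sum_add_distrib, ← hc]
        simp only [hab, Polynomial.coe_add, Polynomial.coe_mul, Polynomial.coe_pow,
          Polynomial.coe_X, Polynomial.coe_zero, zero_mul, add_zero]
        exact Finset.sum_congr rfl fun i _ => by ring
      obtain ⟨hA, hB⟩ := eq_zero_of_sq_add_X_mul_sq hsq
      by_cases haj : a j = 0
      · refine ih n b (by omega) (fun hbj => hcj ?_) hB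
        rw [hab, haj, hbj]
        ring
      · exact ih n a (by omega) haj hA
    · exact ⟨n, c, hc, h0⟩

/-- An algebraic series is an affine function of a series `g` that satisfies a polynomial equation
in which each term that involves `g` is divisible by the variable. -/
theorem exists_guarded_equation {f : PowerSeries (ZMod 2)}
    (hf : IsAlgebraic (Polynomial (ZMod 2)) f) :
    ∃ (g : PowerSeries (ZMod 2)) (p q e : Polynomial (ZMod 2)) (n : ℕ)
      (b : ℕ → Polynomial (ZMod 2)) (N : ℕ → ℕ),
      f = (p : PowerSeries (ZMod 2)) + (q : PowerSeries (ZMod 2)) * g ∧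
        g = (e : PowerSeries (ZMod 2)) +
          ∑ i ∈ Finset.range n, X * (b i : PowerSeries (ZMod 2)) * g ^ N i := by
  obtain ⟨n, c, hc, hc0⟩ := exists_sum_mul_pow_eq_zero hf
  obtain ⟨v, u, hu, hc0⟩ : ∃ (v : ℕ) (u : Polynomial (ZMod 2)), ¬ Polynomial.X ∣ u ∧
      c 0 = Polynomial.X ^ v * u := by
    obtain ⟨u, h, h'⟩ := (FiniteMultiplicity.of_prime_left Polynomial.prime_X
      hc0).exists_eq_pow_mul_and_not_dvd
    exact ⟨_, u, h', h⟩
  rw [Polynomial.X_dvd_iff] at hu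
  have hunit : IsUnit (u : PowerSeries (ZMod 2)) := by
    rw [isUnit_iff_constantCoeff, Polynomial.constantCoeff_coe]
    exact isUnit_iff_ne_zero.2 hu
  obtain ⟨F, rfl⟩ := hunit.dvd (a := f)
  -- In terms of `F = f / u` the coefficient of the linear term is a power of the variable.
  let b : ℕ → Polynomial (ZMod 2) := fun i => c (i + 1) * u ^ (2 ^ (i + 1) - 2)
  have hF : X ^ v * F =
      ∑ i ∈ Finset.range n, (b i : PowerSeries (ZMod 2)) * F ^ 2 ^ (i + 1) := by
    refine CharTwo.add_eq_zero.1 ((hunit.pow 2).mul_left_cancel ?_)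
    rw [mul_zero, ← hc, Finset.sum_range_succ', add_comm, mul_add, Finset.mul_sum, hc0]
    congr 1
    · refine Finset.sum_congr rfl fun i _ => ?_
      have : 2 ^ (i + 1) = 2 ^ (i + 1) - 2 + 2 := by
        have : 2 ≤ 2 ^ (i + 1) := by rw [pow_succ]; have := Nat.one_le_two_pow (n := i); omega
        omega
      simp only [b, Polynomial.coe_mul, Polynomial.coe_pow]
      rw [mul_pow]
      conv_rhs => enter [2, 1]; rw [this]
      ring
    · simp only [Polynomial.coe_mul, Polynomial.coe_pow, Polynomial.coe_X]
      ring
  obtain ⟨g, hg⟩ : X ^ (v + 1) ∣ F -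
      ((trunc (v + 1) F : Polynomial (ZMod 2)) : PowerSeries (ZMod 2)) := by
    rw [X_pow_dvd_iff]
    intro m hm
    rw [map_sub, Polynomial.coeff_coe, coeff_trunc, if_pos hm, sub_self]
  generalize trunc (v + 1) F = Q at hg
  obtain rfl : F = (Q : PowerSeries (ZMod 2)) + X ^ (v + 1) * g := by rw [← hg]; ring
  -- Since raising to the power `2 ^ (i + 1)` is additive, `g` satisfies an equation of the same
  -- shape as `F`, where the linear term has been divided out.
  let N : ℕ → ℕ := fun i => (v + 1) * 2 ^ (i + 1) - (2 * v + 2)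
  have hN : ∀ i, (v + 1) * 2 ^ (i + 1) = 2 * v + 1 + (N i + 1) := fun i => by
    have h1 : 2 ≤ 2 ^ (i + 1) := by rw [pow_succ]; have := Nat.one_le_two_pow (n := i); omega
    have h2 := Nat.mul_le_mul_left (v + 1) h1
    simp only [N]
    omega
  let E : Polynomial (ZMod 2) :=
    Polynomial.X ^ v * Q + ∑ i ∈ Finset.range n, b i * Q ^ 2 ^ (i + 1)
  have hE : (E : PowerSeries (ZMod 2)) = X ^ (2 * v + 1) *
      (g + ∑ i ∈ Finset.range n, X * ((b i : PowerSeries (ZMod 2)) * X ^ N i) * g ^ 2 ^ (i + 1)) := by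
    have h2 : ∀ i, ((Q : PowerSeries (ZMod 2)) + X ^ (v + 1) * g) ^ 2 ^ (i + 1) =
        (Q : PowerSeries (ZMod 2)) ^ 2 ^ (i + 1) +
          X ^ (2 * v + 1) * (X * X ^ N i * g ^ 2 ^ (i + 1)) := fun i => by
      rw [add_pow_char_pow, mul_pow, ← pow_mul, hN]
      ring
    simp only [h2, mul_add, Finset.sum_add_distrib] at hF
    have hcoe : (E : PowerSeries (ZMod 2)) = X ^ v * (Q : PowerSeries (ZMod 2)) +
        ∑ i ∈ Finset.range n, (b i : PowerSeries (ZMod 2)) * (Q : PowerSeries (ZMod 2)) ^ 2 ^ (i + 1) := by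
      simp only [E, Polynomial.coe_add, Polynomial.coe_mul, Polynomial.coe_pow, Polynomial.coe_X]
      congr 1
      rw [← Polynomial.coeToPowerSeries.ringHom_apply, map_sum]
      simp
    have hR : ∑ i ∈ Finset.range n, (b i : PowerSeries (ZMod 2)) *
        (X ^ (2 * v + 1) * (X * X ^ N i * g ^ 2 ^ (i + 1))) = X ^ (2 * v + 1) *
          ∑ i ∈ Finset.range n, X * ((b i : PowerSeries (ZMod 2)) * X ^ N i) * g ^ 2 ^ (i + 1) := by
      rw [Finset.mul_sum]
      exact Finset.sum_congr rfl fun i _ => by ring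
    rw [hR] at hF
    rw [hcoe, mul_add, ← CharTwo.add_eq_zero]
    rw [← CharTwo.add_eq_zero] at hF
    rw [← hF]
    ring
  obtain ⟨e, he⟩ : Polynomial.X ^ (2 * v + 1) ∣ E := by
    rw [Polynomial.X_pow_dvd_iff]
    intro d hd
    rw [← Polynomial.coeff_coe, hE]
    exact X_pow_dvd_iff.1 (dvd_mul_right _ _) d hd
  refine ⟨g, u * Q, u * Polynomial.X ^ (v + 1), e, n, fun i => b i * Polynomial.X ^ N i,
    fun i => 2 ^ (i + 1), ?_, ?_⟩
  · simp only [Polynomial.coe_mul, Polynomial.coe_pow, Polynomial.coe_X]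
    ring
  · rw [he] at hE
    simp only [Polynomial.coe_mul, Polynomial.coe_pow, Polynomial.coe_X] at hE ⊢
    have := mul_left_cancel₀ (pow_ne_zero _ X_ne_zero) hE
    rw [this, add_assoc, CharTwo.add_self_eq_zero, add_zero]

end PowerSeries

namespace MvPowerSeries

open WordSeries

variable {k : ℕ}

theorem subst_X_mem_seriesOn (j : Fin k) (f : PowerSeries (ZMod 2)) :
    PowerSeries.subst (X j : MvPowerSeries (Fin k) (ZMod 2)) f ∈ seriesOn {j} := by
  intro d hd
  rw [PowerSeries.coeff_subst_single] at hd
  split_ifs at hd with h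
  · rw [h]
    exact (Finset.coe_subset.2 Finsupp.support_single_subset).trans (by simp)
  · exact absurd rfl hd

theorem toWordSeries_aeval_mul_mem {j : Fin k} {M : Submodule (ZMod 2) (WordSeries (Fin k))}
    {H : MvPowerSeries (Fin k) (ZMod 2)} (h : ∀ m, toWordSeries (X j ^ m * H) ∈ M)
    (p : Polynomial (ZMod 2)) :
    toWordSeries (Polynomial.aeval (X j : MvPowerSeries (Fin k) (ZMod 2)) p * H) ∈ M := by
  rw [Polynomial.aeval_eq_sum_range, Finset.sum_mul, map_sum]
  refine sum_mem fun m _ => ?_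
  rw [smul_mul_assoc, map_smul]
  exact M.smul_mem _ (h m)

theorem X_pow_mem_span (j : Fin k) (m : ℕ) (φ : WordSeries (Fin k)) :
    toWordSeries (X j ^ m : MvPowerSeries (Fin k) (ZMod 2)) ∈
      Submodule.span (ZMod 2) (ofSymbols id '' Admissible IsGF2 φ) :=
  Submodule.subset_span ⟨List.replicate m (.terminal j),
    fun ψ hψ => by simp [List.mem_replicate] at hψ, ofSymbols_replicate j m⟩

theorem ofSymbols_replicate_nonterminal {j : Fin k} {G : MvPowerSeries (Fin k) (ZMod 2)}
    (hG : G ∈ seriesOn {j}) (n : ℕ) :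
    ofSymbols id (List.replicate n (.nonterminal (toWordSeries G))) = toWordSeries (G ^ n) := by
  induction n with
  | zero => exact toWordSeries_one.symm
  | succ n ih =>
    rw [List.replicate_succ, ofSymbols, ih, ofSymbol, id, pow_succ',
      toWordSeries_mul hG (pow_mem hG n) (by simp)]

theorem X_mul_pow_mem_span {j : Fin k} {G : MvPowerSeries (Fin k) (ZMod 2)}
    (hG : G ∈ seriesOn {j}) (m n : ℕ) :
    toWordSeries (X j ^ (m + 1) * G ^ n) ∈
      Submodule.span (ZMod 2) (ofSymbols id '' Admissible IsGF2 (toWordSeries G)) := by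
  refine Submodule.subset_span ⟨List.replicate (m + 1) (.terminal j) ++
    List.replicate n (.nonterminal (toWordSeries G)), fun ψ hψ => .inr ⟨?_, ?_⟩, ?_⟩
  · simp [List.mem_replicate] at hψ
    exact hψ.2
  · rw [terminalCount_append, terminalCount_replicate]
    omega
  · exact ofSymbols_replicate_append _ (ofSymbols_replicate_nonterminal hG n)
      (pow_mem (seriesOn_mono (by simp) hG) n)

theorem isGF2_of_mem_algSeries {j : Fin k} {F : MvPowerSeries (Fin k) (ZMod 2)}
    (hF : F ∈ algSeries j) : F ∈ seriesOn {j} ∧ IsGF2 (toWordSeries F) := by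
  obtain ⟨f, hf, rfl⟩ := hF
  refine ⟨subst_X_mem_seriesOn j f, ?_⟩
  obtain ⟨g, p, q, e, n, b, N, rfl, hg⟩ := PowerSeries.exists_guarded_equation hf
  have hX : PowerSeries.HasSubst (X j : MvPowerSeries (Fin k) (ZMod 2)) := .X j
  set G := PowerSeries.subst (X j : MvPowerSeries (Fin k) (ZMod 2)) g with hGdef
  have hG : G ∈ seriesOn {j} := subst_X_mem_seriesOn j g
  have hpoly : ∀ (p : Polynomial (ZMod 2)) (φ : WordSeries (Fin k)),
      toWordSeries (Polynomial.aeval (X j : MvPowerSeries (Fin k) (ZMod 2)) p) ∈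
        Submodule.span (ZMod 2) (ofSymbols id '' Admissible IsGF2 φ) := fun p φ => by
    have := toWordSeries_aeval_mul_mem (j := j) (H := 1) (fun m => by
      rw [mul_one]; exact X_pow_mem_span j m φ) p
    rwa [mul_one] at this
  have hGeq : G = Polynomial.aeval (X j : MvPowerSeries (Fin k) (ZMod 2)) e +
      ∑ i ∈ Finset.range n, Polynomial.aeval (X j : MvPowerSeries (Fin k) (ZMod 2)) (b i) *
        (X j * G ^ N i) := by
    conv_lhs => rw [hGdef, hg]
    rw [← PowerSeries.coe_substAlgHom hX, map_add, map_sum, PowerSeries.substAlgHom_coe]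
    congr 1
    refine Finset.sum_congr rfl fun i _ => ?_
    rw [map_mul, map_mul, map_pow, PowerSeries.substAlgHom_coe, PowerSeries.substAlgHom_X,
      PowerSeries.coe_substAlgHom]
    ring
  have hGF : IsGF2 (toWordSeries G) := by
    refine isGF2_of_mem_span ?_
    have : toWordSeries (Polynomial.aeval (X j : MvPowerSeries (Fin k) (ZMod 2)) e +
        ∑ i ∈ Finset.range n, Polynomial.aeval (X j : MvPowerSeries (Fin k) (ZMod 2)) (b i) *
          (X j * G ^ N i)) ∈
        Submodule.span (ZMod 2) (ofSymbols id '' Admissible IsGF2 (toWordSeries G)) := by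
      rw [map_add, map_sum]
      refine add_mem (hpoly e _) (sum_mem fun i _ => toWordSeries_aeval_mul_mem (fun m => ?_) _)
      rw [← mul_assoc, ← pow_succ]
      exact X_mul_pow_mem_span hG m (N i)
    rwa [← hGeq] at this
  have hp : IsGF2 (toWordSeries (Polynomial.aeval (X j : MvPowerSeries (Fin k) (ZMod 2)) p)) :=
    isGF2_of_mem_span (hpoly p _)
  have hq : IsGF2 (toWordSeries (Polynomial.aeval (X j : MvPowerSeries (Fin k) (ZMod 2)) q)) :=
    isGF2_of_mem_span (hpoly q _)
  have hqj := subst_X_mem_seriesOn j (q : PowerSeries (ZMod 2))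
  rw [PowerSeries.subst_coe hX] at hqj
  rw [PowerSeries.subst_add hX, PowerSeries.subst_mul hX, PowerSeries.subst_coe hX,
    PowerSeries.subst_coe hX, map_add, toWordSeries_mul hqj hG (by simp)]
  exact hp.add (hq.cauchyProd hGF)

end MvPowerSeries

/-! ### Quotients along tree-like sets -/

namespace MvPowerSeries

open WordSeries

variable {k : ℕ}

theorem constantCoeff_eq_one {F : MvPowerSeries (Fin k) (ZMod 2)} (h : IsUnit F) :
    constantCoeff F = 1 := by
  have h := (isUnit_iff_constantCoeff.1 h).ne_zero
  revert h
  generalize constantCoeff F = c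
  revert c
  decide

/-- Division by an invertible polynomial in the outermost variables `aₗ` and `aᵣ`: the equation
`F = A + (1 - p) * F` becomes a system of rules that add letters at both ends of a word. -/
theorem isGF2_of_mul_eq {l r : Fin k} (hlr : l < r) {F A : MvPowerSeries (Fin k) (ZMod 2)}
    {p : MvPolynomial (Fin k) (ZMod 2)} (hp : p ∈ MvPolynomial.supported (ZMod 2) {l, r})
    (hunit : IsUnit (p : MvPowerSeries (Fin k) (ZMod 2))) (hA : A ∈ seriesOn (Set.Icc l r))
    (hAF : IsGF2 (toWordSeries A)) (h : F * p = A) :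
    F ∈ seriesOn (Set.Icc l r) ∧ IsGF2 (toWordSeries F) := by
  classical
  let q : MvPolynomial (Fin k) (ZMod 2) := 1 - p
  have hq : q ∈ MvPolynomial.supported (ZMod 2) {l, r} := sub_mem (one_mem _) hp
  have hqp : (q : MvPowerSeries (Fin k) (ZMod 2)) = 1 - p := by
    rw [eq_sub_iff_add_eq, ← MvPolynomial.coe_add, sub_add_cancel, MvPolynomial.coe_one]
  have hq0 : constantCoeff (q : MvPowerSeries (Fin k) (ZMod 2)) = 0 := by
    rw [hqp, map_sub, map_one, constantCoeff_eq_one hunit, sub_self]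
  have hF : F = A + q * F := by
    rw [hqp, ← h]
    ring
  have hsub : ({l, r} : Set (Fin k)) ⊆ Set.Icc l r := by
    rintro i (rfl | rfl)
    exacts [⟨le_rfl, hlr.le⟩, ⟨hlr.le, le_rfl⟩]
  have hFs : F ∈ seriesOn (Set.Icc l r) :=
    mem_seriesOn_of_eq_add_mul hA (seriesOn_mono hsub (coe_mem_seriesOn hq)) hq0 hF
  refine ⟨hFs, isGF2_of_mem_span ?_⟩
  have key : toWordSeries (A + (q : MvPowerSeries (Fin k) (ZMod 2)) * F) ∈
      Submodule.span (ZMod 2) (ofSymbols id '' Admissible IsGF2 (toWordSeries F)) := by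
    have hsum : (q : MvPowerSeries (Fin k) (ZMod 2)) =
        ∑ d ∈ q.support, monomial d (q.coeff d) := by
      conv_lhs => rw [q.as_sum]
      rw [← MvPolynomial.coeToMvPowerSeries.ringHom_apply, map_sum]
      simp
    rw [map_add, hsum, Finset.sum_mul, map_sum]
    refine add_mem hAF.mem_span (sum_mem fun d hd => ?_)
    have hdlr : d = Finsupp.single l (d l) + Finsupp.single r (d r) := by
      ext i
      by_cases hi : i ∈ d.support
      · have : i ∈ ({l, r} : Set (Fin k)) := MvPolynomial.mem_supported.1 hq
          ((MvPolynomial.mem_vars_iff_mem_support i).2 ⟨d, hd, hi⟩)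
        rcases this with rfl | rfl
        · simp [hlr.ne']
        · simp [hlr.ne]
      · have hi := Finsupp.notMem_support_iff.1 hi
        by_cases hil : i = l
        · subst hil; simp [hlr.ne']
        · by_cases hir : i = r
          · subst hir; simp [hlr.ne]
          · simp [hi, Ne.symm hil, Ne.symm hir]
    have hpos : 0 < d l + d r := by
      rw [Nat.pos_iff_ne_zero]
      intro h0
      obtain ⟨h1, h2⟩ := Nat.add_eq_zero_iff.1 h0
      rw [h1, h2, Finsupp.single_zero, Finsupp.single_zero, add_zero] at hdlr
      rw [MvPolynomial.mem_support_iff, hdlr, ← MvPolynomial.coeff_coe,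
        coeff_zero_eq_constantCoeff_apply] at hd
      exact hd hq0
    have hmon : monomial d (q.coeff d) * F = q.coeff d • (X l ^ d l * (F * X r ^ d r)) := by
      rw [X_pow_eq, X_pow_eq, mul_comm F, ← mul_assoc, monomial_mul_monomial, ← hdlr, mul_one,
        ← smul_mul_assoc, ← map_smul, smul_eq_mul, mul_one]
    rw [hmon, map_smul]
    exact Submodule.smul_mem _ _ (mul_mul_mem_span hlr.le hFs hpos)
  rwa [← hF] at key

end MvPowerSeries

theorem TreeLikeOn.bounds {k : ℕ} {l r : Fin k} {Y : Finset (Fin k × Fin k)}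
    (h : TreeLikeOn l r Y) : ∀ e ∈ Y, l ≤ e.1 ∧ e.1 < e.2 ∧ e.2 ≤ r := by
  induction h with
  | base l r h =>
    intro e he
    obtain rfl := Finset.mem_singleton.1 he
    exact ⟨le_rfl, Fin.lt_def.2 (by simp only; omega), le_rfl⟩
  | split l m r hl hr Y₁ Y₂ _ _ ih₁ ih₂ =>
    intro e he
    rcases Finset.mem_insert.1 he with rfl | he
    · exact ⟨le_rfl, hl.trans hr, le_rfl⟩
    · rcases Finset.mem_union.1 he with he | he
      · obtain ⟨h1, h2, h3⟩ := ih₁ e he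
        exact ⟨h1, h2, h3.trans hr.le⟩
      · obtain ⟨h1, h2, h3⟩ := ih₂ e he
        exact ⟨hl.le.trans h1, h2, h3⟩

/-- The product over a tree-like set, split at the root of the tree. -/
theorem TreeLikeOn.prod_split {k : ℕ} {M : Type} [CommMonoid M] {l m r : Fin k} (hl : l < m)
    (hr : m < r) {Y₁ Y₂ : Finset (Fin k × Fin k)} (h₁ : TreeLikeOn l m Y₁)
    (h₂ : TreeLikeOn m r Y₂) (p : Fin k × Fin k → M) :
    ∏ e ∈ insert (l, r) (Y₁ ∪ Y₂), p e = p (l, r) * ((∏ e ∈ Y₁, p e) * ∏ e ∈ Y₂, p e) := by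
  rw [Finset.prod_insert, Finset.prod_union]
  · rw [Finset.disjoint_left]
    intro e he₁ he₂
    obtain ⟨-, h, h'⟩ := h₁.bounds e he₁
    exact absurd (h₂.bounds e he₂).1 (not_le_of_gt (h.trans_le h'))
  · intro he
    rcases Finset.mem_union.1 he with he | he
    · exact absurd (h₁.bounds _ he).2.2 (not_le_of_gt hr)
    · exact absurd (h₂.bounds _ he).1 (not_le_of_gt hl)

theorem one_mem_algSeries {k : ℕ} (j : Fin k) : (1 : MvPowerSeries (Fin k) (ZMod 2)) ∈ algSeries j :=
  ⟨1, isAlgebraic_one, by rw [← PowerSeries.coe_substAlgHom (.X j), map_one]⟩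

theorem isUnit_prod_coe {k : ℕ} {Y : Finset (Fin k × Fin k)}
    {p : Fin k × Fin k → MvPolynomial (Fin k) (ZMod 2)}
    (hp : ∀ e ∈ Y, IsUnit (p e : MvPowerSeries (Fin k) (ZMod 2))) :
    IsUnit (∏ e ∈ Y, (p e : MvPowerSeries (Fin k) (ZMod 2))) :=
  Finset.prod_induction _ IsUnit (fun _ _ => IsUnit.mul) isUnit_one hp

open MvPowerSeries WordSeries in
/-- The quotient of a product of algebraic univariate series by polynomials indexed by a tree-like
set is definable, by recursion on the tree: the quotients of the two parts of a segment are
multiplied, where the factor in the common variable is given to the left part, and then the result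
is divided by the polynomial in the outermost variables. -/
theorem TreeLikeOn.isGF2 {k : ℕ} {l r : Fin k} {Y : Finset (Fin k × Fin k)}
    (hY : TreeLikeOn l r Y) {A : Fin k → MvPowerSeries (Fin k) (ZMod 2)}
    (hA : ∀ j, A j ∈ algSeries j) {p : Fin k × Fin k → MvPolynomial (Fin k) (ZMod 2)}
    (hp : ∀ e ∈ Y, p e ∈ MvPolynomial.supported (ZMod 2) ({e.1, e.2} : Set (Fin k)) ∧
      IsUnit (p e : MvPowerSeries (Fin k) (ZMod 2))) {F : MvPowerSeries (Fin k) (ZMod 2)}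
    (hF : F * ∏ e ∈ Y, (p e : MvPowerSeries (Fin k) (ZMod 2)) = ∏ j ∈ Finset.Icc l r, A j) :
    F ∈ seriesOn (Set.Icc l r) ∧ IsGF2 (toWordSeries F) := by
  classical
  induction hY generalizing A F with
  | base l r h =>
    have hlt : l < r := Fin.lt_def.2 (by omega)
    have hIcc : Finset.Icc l r = {l, r} := by
      ext i
      simp only [Finset.mem_Icc, Finset.mem_insert, Finset.mem_singleton, Fin.le_def, Fin.ext_iff]
      omega
    rw [Finset.prod_singleton, hIcc, Finset.prod_pair hlt.ne] at hF
    obtain ⟨hl, hlF⟩ := isGF2_of_mem_algSeries (hA l)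
    obtain ⟨hr, hrF⟩ := isGF2_of_mem_algSeries (hA r)
    obtain ⟨hps, hpu⟩ := hp (l, r) (by simp)
    refine isGF2_of_mul_eq hlt hps hpu (mul_mem (seriesOn_mono (by simp [hlt.le]) hl)
      (seriesOn_mono (by simp [hlt.le]) hr)) ?_ hF
    rw [toWordSeries_mul hl hr (by simpa using hlt.le)]
    exact hlF.cauchyProd hrF
  | split l m r hl hr Y₁ Y₂ h₁ h₂ ih₁ ih₂ =>
    have hp₁ := fun e (he : e ∈ Y₁) => hp e (by simp [he])
    have hp₂ := fun e (he : e ∈ Y₂) => hp e (by simp [he])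
    obtain ⟨hps, hpu⟩ := hp (l, r) (by simp)
    obtain ⟨u₁, hu₁⟩ := isUnit_prod_coe fun e he => (hp₁ e he).2
    obtain ⟨u₂, hu₂⟩ := isUnit_prod_coe fun e he => (hp₂ e he).2
    have hA' : ∀ j, Function.update A m 1 j ∈ algSeries j := fun j => by
      rcases eq_or_ne j m with rfl | hj
      · rw [Function.update_self]
        exact one_mem_algSeries j
      · rw [Function.update_of_ne hj]
        exact hA j
    have hprod : ∏ j ∈ Finset.Icc l r, A j =
        (∏ j ∈ Finset.Icc l m, A j) * ∏ j ∈ Finset.Icc m r, Function.update A m 1 j := by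
      rw [← Finset.Ioc_insert_left hr.le, Finset.prod_insert Finset.left_notMem_Ioc,
        Function.update_self, one_mul]
      have : ∏ j ∈ Finset.Ioc m r, Function.update A m 1 j = ∏ j ∈ Finset.Ioc m r, A j :=
        Finset.prod_congr rfl fun j hj =>
          Function.update_of_ne (Finset.mem_Ioc.1 hj).1.ne' _ _
      rw [this, ← Finset.prod_union]
      · congr 1
        ext i
        simp only [Finset.mem_Icc, Finset.mem_union, Finset.mem_Ioc, Fin.le_def, Fin.lt_def] at *
        omega
      · rw [Finset.disjoint_left]
        intro i hi hi'
        exact absurd (Finset.mem_Icc.1 hi).2 (not_le_of_gt (Finset.mem_Ioc.1 hi').1)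
    obtain ⟨h₁s, h₁F⟩ := ih₁ hA hp₁ (F := (∏ j ∈ Finset.Icc l m, A j) * ↑u₁⁻¹) (by
      rw [← hu₁, Units.inv_mul_cancel_right])
    obtain ⟨h₂s, h₂F⟩ := ih₂ hA' hp₂
      (F := (∏ j ∈ Finset.Icc m r, Function.update A m 1 j) * ↑u₂⁻¹) (by
      rw [← hu₂, Units.inv_mul_cancel_right])
    refine isGF2_of_mul_eq (hl.trans hr) hps hpu
      (mul_mem (seriesOn_mono (Set.Icc_subset_Icc_right hr.le) h₁s)
        (seriesOn_mono (Set.Icc_subset_Icc_left hl.le) h₂s)) ?_ ?_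
    · rw [toWordSeries_mul h₁s h₂s fun i hi j hj => hi.2.trans hj.1]
      exact h₁F.cauchyProd h₂F
    · rw [TreeLikeOn.prod_split hl hr h₁ h₂, hprod, ← hu₁, ← hu₂] at hF
      rw [mul_mul_mul_comm, ← hF, ← Units.val_mul, ← Units.val_mul, ← mul_inv, ← mul_assoc F,
        Units.mul_inv_cancel_right]

open MvPowerSeries WordSeries in
theorem isGF2_of_mem_withInv {k : ℕ} {Y : Finset (Fin k × Fin k)} (hY : IsTreeLike Y)
    {F : MvPowerSeries (Fin k) (ZMod 2)} (hF : F ∈ withInv (numeratorRing k) Y) :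
    IsGF2 (toWordSeries F) := by
  obtain ⟨l, r, hl, hr, hY⟩ := hY
  obtain ⟨t, ⟨n, A, hA, rfl⟩, p, hp, hF⟩ := hF
  obtain ⟨u, hu⟩ := isUnit_prod_coe fun e he => (hp e he).2
  have huniv : Finset.Icc l r = Finset.univ := by
    ext i
    have := i.2
    simp only [Finset.mem_Icc, Fin.le_def, Finset.mem_univ, iff_true]
    omega
  obtain rfl : F = ∑ i, (∏ j, A i j) * ↑u⁻¹ := by
    rw [← Finset.sum_mul, ← hF, ← hu, Units.mul_inv_cancel_right]
  rw [map_sum]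
  refine Finset.sum_induction _ IsGF2 (fun _ _ => IsGF2.add) isGF2_zero fun i _ => ?_
  refine (hY.isGF2 (hA i) hp ?_).2
  rw [huniv, ← hu, Units.inv_mul_cancel_right]

open MvPowerSeries in
theorem toWordSeries_asSeries {k : ℕ} {K : Language (Fin k)} (hK : K ≤ starProduct k)
    (w : List (Fin k)) : toWordSeries (asSeries K) w = 1 ↔ w ∈ K := by
  classical
  rw [toWordSeries_apply]
  split_ifs with hw
  · change (if orderedWord (exponents w) ∈ K then (1 : ZMod 2) else 0) = 1 ↔ _
    rw [orderedWord_exponents hw]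
    simp
  · refine iff_of_false zero_ne_one fun hwK => hw ?_
    obtain ⟨d, rfl⟩ := hK hwK
    exact pairwise_orderedWord d

theorem theorem3p1 (k : ℕ) (K : Language (Fin k)) (hK : K ≤ starProduct k)
    (n : ℕ) (f : Fin n → MvPowerSeries (Fin k) (ZMod 2)) (Y : Fin n → Finset (Fin k × Fin k))
    (hY : ∀ i, IsTreeLike (Y i)) (hf : ∀ i, f i ∈ withInv (numeratorRing k) (Y i))
    (hsum : asSeries K = ∑ i, f i) :
    ∃ G : GF2Grammar (Fin k), G.language = K := by
  have h : WordSeries.IsGF2 (MvPowerSeries.toWordSeries (asSeries K)) := by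
    rw [hsum, map_sum]
    exact Finset.sum_induction _ WordSeries.IsGF2 (fun _ _ => WordSeries.IsGF2.add)
      WordSeries.isGF2_zero fun i _ => isGF2_of_mem_withInv (hY i) (hf i)
  obtain ⟨G, hG⟩ := h.exists_grammar
  exact ⟨G, Set.ext fun w => (hG w).trans (toWordSeries_asSeries hK w)⟩
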